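/- For a finite graph $G$, let $\tau(G)$ be the maximum number of colors in a (not necessarily proper) edge-coloring of $G$ in which every color is used and no two color classes are isomorphic as graphs. Let $G(n,p)$ be the binomial (Erdős–Rényi) random graph on $n$ vertices, in which each pair of vertices is an edge independently with probability $p$. There are absolute constants $C, a, b > 0$ such that for every sequence $p = p(n) \in [0,1]$ with $$\frac{C\log n}{n} \le p \le \frac{1}{\log n}$$ for all sufficiently large $n$, the random graph $G = G(n,p)$ satisfies $$a\,\frac{p n^2}{\log n} \;\le\; \tau(G) \;\le\; b\,\frac{p n^2 \log\log n}{\log n}$$ asymptotically almost surely, that is, with probability tending to $1$ as $n \to \infty$. -/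

import Mathlib

namespace SimpleGraph

/-- `C` is an edge-coloring of `G` (not necessarily proper) in which every color is used and no two
color classes are isomorphic as graphs. The color classes are regarded as spanning subgraphs; when
the vertex set is finite, two of them are isomorphic exactly when they are isomorphic after deletion
of their isolated vertices, because they have the same number of vertices. -/
def IsNonIsoEdgeColoring {V : Type*} {G : SimpleGraph V} {K : Type*} (C : G.EdgeLabeling K) :
    Prop :=
  Function.Surjective C ∧ ∀ i j : K, i ≠ j → ¬ Nonempty (C.labelGraph i ≃g C.labelGraph j)

/-- `τ(G)`: the maximum number of colors in an edge-coloring of `G` whose color classes are nonempty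
and pairwise non-isomorphic. -/
noncomputable def tau {V : Type*} (G : SimpleGraph V) : ℕ :=
  sSup {k : ℕ | ∃ C : G.EdgeLabeling (Fin k), IsNonIsoEdgeColoring C}

/-- On a finite vertex set the maximum in the definition of `τ(G)` is attained. -/
theorem isGreatest_tau {V : Type*} [Finite V] (G : SimpleGraph V) :
    IsGreatest {k : ℕ | ∃ C : G.EdgeLabeling (Fin k), IsNonIsoEdgeColoring C} G.tau := by
  have hb : BddAbove {k : ℕ | ∃ C : G.EdgeLabeling (Fin k), IsNonIsoEdgeColoring C} := by
    refine ⟨Nat.card G.edgeSet, ?_⟩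
    rintro k ⟨C, hC, -⟩
    simpa using Nat.card_le_card_of_surjective (C : G.edgeSet → Fin k) hC
  have hne : {k : ℕ | ∃ C : G.EdgeLabeling (Fin k), IsNonIsoEdgeColoring C}.Nonempty := by
    rcases isEmpty_or_nonempty G.edgeSet with h | ⟨⟨e⟩⟩
    · exact ⟨0, fun e => h.elim e, fun i => i.elim0, fun i => i.elim0⟩
    · exact ⟨1, fun _ => 0, fun i => ⟨e, Subsingleton.elim _ _⟩,
        fun i j hij => absurd (Subsingleton.elim i j) hij⟩
  exact ⟨Nat.sSup_mem hne hb, fun k hk => le_csSup hb hk⟩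

end SimpleGraph

/-! Randomness enters only through the number `m` of edges. By Chebyshev, `m` is of order `p n ^ 2`
with probability tending to 1, so it suffices to bound `tau` by deterministic functions of `m` and
`n`.

Upper bound (`mul_tau_le`): at most `m / k` colors have `k` or more edges, and the smaller colors
represent distinct isomorphism types, of which there are at most `(2k)^(2k)`. Taking `k` of order
`log n / log log n` makes this number at most `n`, which is negligible compared with `m / k`.

Lower bound: trees with `O(log n)` edges already have more isomorphism types than `G` has edges.
Caterpillars of height `L` encode the numbers below `2 ^ (L - 1)` (`eq_of_caterpillar_iso`). Any
graph with enough edges has a subgraph of large minimum degree on its nonisolated vertices, where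
each such tree embeds greedily. Removing the copies one at a time gives about `m / log n`
edge-disjoint, pairwise nonisomorphic subgraphs, and the leftover edges form one further color, too
large to be isomorphic to any of them (`succ_le_tau`). -/

open MeasureTheory ProbabilityTheory in
/-- Chebyshev's inequality for the number of edges of the binomial random graph. -/
theorem SimpleGraph.binomialRandom_real_edgeSet_ncard_le {V : Type*} [Finite V] (p : unitInterval)
    {t : ℝ} (ht : 0 < t) :
    (SimpleGraph.binomialRandom V p).real
      {G | t ≤ |(G.edgeSet.ncard : ℝ) - (Nat.card V).choose 2 * p|} ≤
      (Nat.card V).choose 2 * p / t ^ 2 := by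
  classical
  cases nonempty_fintype V
  have hN : (Sym2.diagSetᶜ : Set (Sym2 V)).ncard = (Nat.card V).choose 2 := by
    rw [Nat.card_eq_fintype_card, ← Sym2.card_diagSet_compl, Fintype.card_eq_nat_card,
      ← Nat.card_coe_set_eq]
  have hu : (Sym2.diagSetᶜ : Set (Sym2 V)).Finite := Set.toFinite _
  set N := (Nat.card V).choose 2 with hNdef
  set S : Finset ℕ := (Finset.range (N + 1)).filter fun k => t ≤ |(k : ℝ) - N * p| with hS
  set μ := (setBernoulli (Sym2.diagSetᶜ : Set (Sym2 V)) p).map Set.ncard with hμ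
  have h1 : (SimpleGraph.binomialRandom V p).real
      {G | t ≤ |(G.edgeSet.ncard : ℝ) - N * p|} ≤ μ.real (S : Set ℕ) := by
    rw [measureReal_def, SimpleGraph.binomialRandom_apply', measureReal_def, hμ,
      map_ncard_setBernoulli_apply]
    refine ENNReal.toReal_mono (measure_ne_top _ _) (measure_mono ?_)
    rintro _ ⟨G, hG, rfl⟩
    have hsub := G.edgeSet_subset_compl_diagSet
    refine ⟨hsub, ?_⟩
    have := Set.ncard_le_ncard hsub hu
    simp only [hS, Finset.coe_filter, Finset.mem_range, Set.mem_ofPred_eq]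
    exact ⟨by omega, hG⟩
  refine h1.trans ?_
  have h2 : μ.real (S : Set ℕ) = ∑ k ∈ S, (N.choose k * (p : ℝ) ^ k * (1 - p) ^ (N - k)) := by
    rw [← sum_measureReal_singleton]
    refine Finset.sum_congr rfl fun k _ => ?_
    rw [hμ, map_ncard_setBernoulli_real_singleton hu, hN]
  rw [h2]
  have hp0 : (0 : ℝ) ≤ p := p.2.1
  have hp1 : (0 : ℝ) ≤ 1 - p := sub_nonneg.2 p.2.2
  -- The variance of the binomial law, read off from the Bernstein polynomial identity evaluated at
  -- `p`.
  have h3 : ∑ k ∈ Finset.range (N + 1), ((N : ℝ) * p - k) ^ 2 *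
      (N.choose k * (p : ℝ) ^ k * (1 - p) ^ (N - k)) = (N : ℝ) * p * (1 - p) := by
    have := congrArg (Polynomial.eval (p : ℝ)) (bernsteinPolynomial.variance ℝ N)
    simpa [Polynomial.eval_finsetSum, bernsteinPolynomial] using this
  rw [le_div_iff₀ (by positivity), Finset.sum_mul]
  calc ∑ k ∈ S, N.choose k * (p : ℝ) ^ k * (1 - p) ^ (N - k) * t ^ 2
      ≤ ∑ k ∈ S, ((N : ℝ) * p - k) ^ 2 * (N.choose k * (p : ℝ) ^ k * (1 - p) ^ (N - k)) := by
        refine Finset.sum_le_sum fun k hk => ?_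
        rw [mul_comm]
        gcongr ?_ * _
        have := (Finset.mem_filter.1 hk).2
        calc t ^ 2 ≤ |(k : ℝ) - N * p| ^ 2 := by gcongr
          _ = _ := by rw [sq_abs]; ring
    _ ≤ ∑ k ∈ Finset.range (N + 1), ((N : ℝ) * p - k) ^ 2 *
          (N.choose k * (p : ℝ) ^ k * (1 - p) ^ (N - k)) := by
        refine Finset.sum_le_sum_of_subset_of_nonneg (Finset.filter_subset _ _) fun k _ _ => ?_
        positivity
    _ = N * p * (1 - p) := h3
    _ ≤ N * p := by
        refine mul_le_of_le_one_right (by positivity) (by linarith)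

/-! ### Upper bound: counting small isomorphism types -/

theorem Equiv.Perm.exists_mapsTo_of_card_le {α : Type*} [Finite α] {s t : Finset α}
    (h : s.card ≤ t.card) : ∃ σ : Equiv.Perm α, ∀ x ∈ s, σ x ∈ t := by
  classical
  cases nonempty_fintype α
  obtain ⟨t', ht', hc⟩ := Finset.exists_subset_card_eq h
  let e : {x // x ∈ s} ≃ {x // x ∈ t'} := Finset.equivOfCardEq hc.symm
  exact ⟨e.extendSubtype, fun x hx => ht' (e.extendSubtype_mem x hx)⟩

namespace SimpleGraph

/-- A graph with between `1` and `k` edges is isomorphic to one all of whose edges are listed by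
`k` pairs of elements of a given set of `2 * k` vertices. -/
theorem exists_iso_edgeSet_eq_range {V : Type*} [Finite V] {k : ℕ} {W : Finset V}
    (hW : 2 * k ≤ W.card) {H : SimpleGraph V} (hne : H.edgeSet.Nonempty)
    (hk : H.edgeSet.ncard ≤ k) :
    ∃ c : Fin k → V × V, (∀ a, c a ∈ W ×ˢ W) ∧ ∃ H' : SimpleGraph V,
      Nonempty (H ≃g H') ∧ H'.edgeSet = Set.range fun a => s((c a).1, (c a).2) := by
  classical
  cases nonempty_fintype V
  obtain ⟨c, hc⟩ : ∃ c : Fin k → V × V, H.edgeSet = Set.range fun a => s((c a).1, (c a).2) := by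
    have : Nonempty H.edgeSet := hne.to_subtype
    have : Nonempty (H.edgeSet ↪ Fin k) := by
      rw [Function.Embedding.nonempty_iff_card_le]
      rwa [Fintype.card_fin, ← Nat.card_eq_fintype_card, Nat.card_coe_set_eq]
    obtain ⟨g⟩ := this
    -- With fewer than `k` edges the list repeats some of them; nonemptiness supplies the default
    -- value of `invFun`.
    let q : Fin k → H.edgeSet := Function.invFun g
    have hq : Function.Surjective q := Function.invFun_surjective g.injective
    have hout : ∀ a, s((q a : Sym2 V).out.1, (q a : Sym2 V).out.2) = q a := fun a => Quot.out_eq _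
    refine ⟨fun a => (q a : Sym2 V).out, ?_⟩
    simp only [hout]
    ext e
    refine ⟨fun he => ?_, ?_⟩
    · obtain ⟨a, ha⟩ := hq ⟨e, he⟩
      exact ⟨a, congrArg Subtype.val ha⟩
    · rintro ⟨a, rfl⟩
      exact (q a).2
  let U : Finset V := (Finset.univ.image fun a => (c a).1) ∪ (Finset.univ.image fun a => (c a).2)
  have hU : U.card ≤ W.card := by
    refine (Finset.card_union_le _ _).trans (le_trans ?_ hW)
    have h1 := Finset.card_image_le (s := Finset.univ) (f := fun a => (c a).1)
    have h2 := Finset.card_image_le (s := Finset.univ) (f := fun a => (c a).2)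
    simp only [Finset.card_univ, Fintype.card_fin] at h1 h2
    omega
  obtain ⟨σ, hσ⟩ := Equiv.Perm.exists_mapsTo_of_card_le hU
  refine ⟨fun a => (σ (c a).1, σ (c a).2), fun a => ?_, H.map σ.toEmbedding,
    ⟨SimpleGraph.Iso.map σ H⟩, ?_⟩
  · simp only [Finset.mem_product]
    exact ⟨hσ _ (by simp [U]), hσ _ (by simp [U])⟩
  · rw [SimpleGraph.edgeSet_map, hc, ← Set.range_comp]
    rfl

theorem EdgeLabeling.sum_ncard_edgeSet_labelGraph {V K : Type*} [Finite V] [Fintype K]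
    {G : SimpleGraph V} (C : G.EdgeLabeling K) :
    ∑ i, (C.labelGraph i).edgeSet.ncard = G.edgeSet.ncard := by
  classical
  have h : ∀ i, (C.labelGraph i).edgeSet.Finite := fun i => Set.toFinite _
  have hu : G.edgeSet = ⋃ i, (C.labelGraph i).edgeSet := by
    conv_lhs => rw [← C.iSup_labelGraph]
    exact edgeSet_iSup
  rw [hu, Set.ncard_iUnion_of_finite h, finsum_eq_sum_of_fintype]
  intro i j hij
  exact disjoint_edgeSet.2 (EdgeLabeling.pairwise_disjoint_labelGraph hij)

/-- The colors used at least `k` times number at most `e(G) / k`, and the others are bounded by the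
number of isomorphism types of graphs with fewer than `k` edges. -/
theorem mul_tau_le {V : Type*} [Finite V] (G : SimpleGraph V) {k : ℕ}
    (hk : 2 * k ≤ Nat.card V) :
    k * G.tau ≤ G.edgeSet.ncard + k * (2 * k) ^ (2 * k) := by
  classical
  cases nonempty_fintype V
  obtain ⟨C, hsurj, hiso⟩ := G.isGreatest_tau.1
  obtain ⟨W, hW⟩ : ∃ W : Finset V, W.card = 2 * k := by
    rw [Nat.card_eq_fintype_card, ← Finset.card_univ] at hk
    obtain ⟨W, -, hW⟩ := Finset.exists_subset_card_eq hk
    exact ⟨W, hW⟩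
  let S : Finset (Fin G.tau) := Finset.univ.filter fun i => (C.labelGraph i).edgeSet.ncard < k
  have hS : S.card ≤ (2 * k) ^ (2 * k) := by
    have key : ∀ i ∈ S, ∃ c : Fin k → V × V, (∀ a, c a ∈ W ×ˢ W) ∧ ∃ H' : SimpleGraph V,
        Nonempty (C.labelGraph i ≃g H') ∧
          H'.edgeSet = Set.range fun a => s((c a).1, (c a).2) := by
      intro i hi
      refine exists_iso_edgeSet_eq_range hW.ge ?_ (Finset.mem_filter.1 hi).2.le
      obtain ⟨⟨e, he⟩, rfl⟩ := hsurj i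
      induction e with
      | h x y => exact ⟨s(x, y), (EdgeLabeling.labelGraph_adj x y).2 ⟨he, rfl⟩⟩
    choose c hcW H' hH' hcH' using key
    have : S.card ≤ (Fintype.piFinset fun _ : Fin k => W ×ˢ W).card := by
      rw [← Finset.card_attach]
      refine Finset.card_le_card_of_injOn (fun i => c i.1 i.2) (fun i _ => ?_) ?_
      · simpa [Fintype.mem_piFinset] using hcW i.1 i.2
      · rintro ⟨i, hi⟩ - ⟨j, hj⟩ - hij
        by_contra hne
        -- The code `c` determines the edge set of the representative, so equal codes force
        -- isomorphic color classes.
        have hHH : H' i hi = H' j hj := by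
          rw [← edgeSet_inj, hcH' i hi, hcH' j hj]
          exact congrArg (fun c : Fin k → V × V => Set.range fun a => s((c a).1, (c a).2)) hij
        obtain ⟨f⟩ := hH' i hi
        obtain ⟨g⟩ := hH' j hj
        rw [← hHH] at g
        exact hiso i j (fun h => hne (Subtype.ext h)) ⟨f.trans g.symm⟩
    refine this.trans (le_of_eq ?_)
    rw [Fintype.card_piFinset]
    simp only [Finset.card_product, hW, Finset.prod_const, Finset.card_univ, Fintype.card_fin]
    rw [← pow_two, ← pow_mul]
  have hB : k * Sᶜ.card ≤ G.edgeSet.ncard := by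
    calc k * Sᶜ.card = ∑ i ∈ Sᶜ, k := by simp [mul_comm]
      _ ≤ ∑ i ∈ Sᶜ, (C.labelGraph i).edgeSet.ncard :=
          Finset.sum_le_sum fun i hi => by simpa [S] using hi
      _ ≤ ∑ i, (C.labelGraph i).edgeSet.ncard :=
          Finset.sum_le_sum_of_subset (Finset.subset_univ _)
      _ = G.edgeSet.ncard := C.sum_ncard_edgeSet_labelGraph
  have := Finset.card_add_card_compl S
  rw [Fintype.card_fin] at this
  calc k * G.tau = k * Sᶜ.card + k * S.card := by rw [← mul_add, add_comm, this]
    _ ≤ _ := by gcongr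

end SimpleGraph
namespace SimpleGraph

/-! ### Caterpillars -/

/-- The parent of a vertex of the universal caterpillar: the root is `0`, the vertices at level
`d ≥ 1` are `4 * d - 3, …, 4 * d`, and each of them hangs from the first vertex of the level
below. -/
def caterpillarParent (j : ℕ) : ℕ := 4 * ((j - 1) / 4) - 3

/-- The nonroot vertices of the caterpillar of height `L` encoding the number `i`: all the vertices
of level `1`, the spine, and a leaf at level `d + 2` for every binary digit `1` of `i` at
position `d`. -/
def IsCaterpillarVertex (L i j : ℕ) : Prop :=
  1 ≤ j ∧ j ≤ 4 * L ∧ (j ≤ 4 ∨ j % 4 = 1 ∨ j % 4 = 2 ∧ i.testBit ((j + 3) / 4 - 2) = true)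

variable {V : Type*}

/-- The caterpillar of height `L` encoding the number `i`, drawn on the vertices `f 0, f 1, …`. -/
def caterpillar (f : ℕ → V) (L i : ℕ) : SimpleGraph V :=
  fromEdgeSet ((fun j => s(f j, f (caterpillarParent j))) '' {j | IsCaterpillarVertex L i j})

theorem caterpillarParent_lt {j : ℕ} (hj : 1 ≤ j) : caterpillarParent j < j := by
  unfold caterpillarParent; omega

theorem level_caterpillarParent {j : ℕ} (hj : 1 ≤ j) :
    (caterpillarParent j + 3) / 4 + 1 = (j + 3) / 4 := by
  unfold caterpillarParent; omega

theorem IsCaterpillarVertex.parent {L i j : ℕ} (hj : IsCaterpillarVertex L i j) :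
    caterpillarParent j = 0 ∨ IsCaterpillarVertex L i (caterpillarParent j) := by
  obtain ⟨h1, h2, -⟩ := hj
  by_cases h : j ≤ 4
  · left; unfold caterpillarParent; omega
  · right
    refine ⟨?_, ?_, Or.inr (Or.inl ?_)⟩ <;> unfold caterpillarParent <;> omega

theorem caterpillar_adj_parent {f : ℕ → V} {L i j : ℕ} (hf : Set.InjOn f (Set.Iic (4 * L)))
    (hj : IsCaterpillarVertex L i j) : (caterpillar f L i).Adj (f j) (f (caterpillarParent j)) := by
  have hlt := caterpillarParent_lt hj.1
  rw [caterpillar, fromEdgeSet_adj]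
  refine ⟨⟨j, hj, rfl⟩, fun h => ?_⟩
  have := hf (Set.mem_Iic.2 hj.2.1) (Set.mem_Iic.2 (hlt.le.trans hj.2.1)) h
  omega

theorem exists_of_caterpillar_adj {f : ℕ → V} {L i : ℕ} {x y : V}
    (h : (caterpillar f L i).Adj x y) : ∃ j, IsCaterpillarVertex L i j ∧
      (x = f j ∧ y = f (caterpillarParent j) ∨ x = f (caterpillarParent j) ∧ y = f j) := by
  rw [caterpillar, fromEdgeSet_adj] at h
  obtain ⟨⟨j, hj, he⟩, -⟩ := h
  refine ⟨j, hj, ?_⟩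
  simp only [Sym2.eq_iff] at he
  grind

theorem caterpillar_le {f : ℕ → V} {L i : ℕ} {G : SimpleGraph V}
    (h : ∀ j, 1 ≤ j → j ≤ 4 * L → G.Adj (f j) (f (caterpillarParent j))) :
    caterpillar f L i ≤ G := by
  intro x y hxy
  obtain ⟨j, hj, ⟨rfl, rfl⟩ | ⟨rfl, rfl⟩⟩ := exists_of_caterpillar_adj hxy
  · exact h j hj.1 hj.2.1
  · exact (h j hj.1 hj.2.1).symm

theorem ncard_edgeSet_caterpillar_le (f : ℕ → V) (L i : ℕ) :
    (caterpillar f L i).edgeSet.ncard ≤ 4 * L := by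
  have hsub : {j | IsCaterpillarVertex L i j} ⊆ Set.Icc 1 (4 * L) := fun j hj => ⟨hj.1, hj.2.1⟩
  have hfin : {j | IsCaterpillarVertex L i j}.Finite := (Set.finite_Icc _ _).subset hsub
  calc (caterpillar f L i).edgeSet.ncard
      ≤ ((fun j => s(f j, f (caterpillarParent j))) '' {j | IsCaterpillarVertex L i j}).ncard := by
        refine Set.ncard_le_ncard ?_ (hfin.image _)
        rw [caterpillar, edgeSet_fromEdgeSet]
        exact Set.sdiff_subset
    _ ≤ {j | IsCaterpillarVertex L i j}.ncard := Set.ncard_image_le hfin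
    _ ≤ (Set.Icc 1 (4 * L)).ncard := Set.ncard_le_ncard hsub (Set.finite_Icc _ _)
    _ = 4 * L := by simp

/-- The root of a caterpillar has degree at least four. -/
theorem four_le_ncard_neighborSet_caterpillar [Finite V] {f : ℕ → V} {L i : ℕ} (hL : 1 ≤ L)
    (hf : Set.InjOn f (Set.Iic (4 * L))) : 4 ≤ ((caterpillar f L i).neighborSet (f 0)).ncard := by
  have h1 : f '' Set.Icc 1 4 ⊆ (caterpillar f L i).neighborSet (f 0) := by
    rintro _ ⟨j, ⟨hj1, hj4⟩, rfl⟩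
    have := caterpillar_adj_parent (i := i) hf ⟨hj1, by omega, Or.inl hj4⟩
    have h0 : caterpillarParent j = 0 := by unfold caterpillarParent; omega
    rw [h0] at this
    exact this.symm
  have h2 : (f '' Set.Icc 1 4).ncard = 4 := by
    rw [Set.InjOn.ncard_image (hf.mono fun j hj => Set.mem_Iic.2 (by have := hj.2; omega))]
    simp
  rw [← h2]
  exact Set.ncard_le_ncard h1

/-- Only the root of a caterpillar has degree at least four. -/
theorem eq_root_of_four_le_ncard_neighborSet {f : ℕ → V} {L i : ℕ}
    (hf : Set.InjOn f (Set.Iic (4 * L))) {x : V}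
    (hx : 4 ≤ ((caterpillar f L i).neighborSet x).ncard) : x = f 0 := by
  by_contra hne
  obtain ⟨y, hy⟩ : ((caterpillar f L i).neighborSet x).Nonempty :=
    Set.nonempty_of_ncard_ne_zero (by omega)
  obtain ⟨j, hj0, hjL, rfl⟩ : ∃ j, 1 ≤ j ∧ j ≤ 4 * L ∧ x = f j := by
    obtain ⟨j, hj, ⟨rfl, rfl⟩ | ⟨rfl, rfl⟩⟩ := exists_of_caterpillar_adj hy
    · exact ⟨j, hj.1, hj.2.1, rfl⟩
    · have := caterpillarParent_lt hj.1
      refine ⟨_, Nat.one_le_iff_ne_zero.2 fun h => hne (by rw [h]), this.le.trans hj.2.1, rfl⟩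
  -- A nonroot vertex has at most three neighbors: its parent, and the spine vertex and digit leaf
  -- of the next level. Only level 1 can hold four vertices.
  have hsub : (caterpillar f L i).neighborSet (f j) ⊆
      {f (caterpillarParent j), f (4 * ((j + 3) / 4) + 1), f (4 * ((j + 3) / 4) + 2)} := by
    intro y hy
    obtain ⟨k, hk, ⟨h1, rfl⟩ | ⟨h1, rfl⟩⟩ := exists_of_caterpillar_adj hy
    · have := hf (Set.mem_Iic.2 hjL) (Set.mem_Iic.2 hk.2.1) h1
      subst this
      simp
    · have hlt := caterpillarParent_lt hk.1
      have := hf (Set.mem_Iic.2 hjL) (Set.mem_Iic.2 (hlt.le.trans hk.2.1)) h1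
      have hk' : k = 4 * ((j + 3) / 4) + 1 ∨ k = 4 * ((j + 3) / 4) + 2 := by
        obtain ⟨h1, h2, h3⟩ := hk
        unfold caterpillarParent at this
        omega
      rcases hk' with h | h <;> simp [← h]
  have h3 := Set.ncard_le_ncard hsub (Set.toFinite _)
  have h4 := Set.ncard_insert_le (f (caterpillarParent j))
    {f (4 * ((j + 3) / 4) + 1), f (4 * ((j + 3) / 4) + 2)}
  have h5 := Set.ncard_insert_le (f (4 * ((j + 3) / 4) + 1)) {f (4 * ((j + 3) / 4) + 2)}
  rw [Set.ncard_singleton] at h5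
  omega

theorem exists_walk_caterpillar {f : ℕ → V} {L i : ℕ} (hf : Set.InjOn f (Set.Iic (4 * L))) (j : ℕ)
    (hj : j = 0 ∨ IsCaterpillarVertex L i j) :
    ∃ w : (caterpillar f L i).Walk (f j) (f 0), w.length = (j + 3) / 4 := by
  induction j using Nat.strong_induction_on with
  | _ j ih =>
    rcases hj with rfl | hj
    · exact ⟨.nil, rfl⟩
    · obtain ⟨w, hw⟩ := ih _ (caterpillarParent_lt hj.1) hj.parent
      refine ⟨.cons (caterpillar_adj_parent hf hj) w, ?_⟩
      rw [Walk.length_cons, hw, level_caterpillarParent hj.1]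

/-- Each edge joins consecutive levels, so a walk to the root needs at least as many steps as the
level of its start. This is the lower bound matching `exists_walk_caterpillar`: distance to the root
equals level. -/
theorem level_le_length_caterpillar {f : ℕ → V} {L i : ℕ} (hf : Set.InjOn f (Set.Iic (4 * L)))
    {x y : V} (w : (caterpillar f L i).Walk x y) (hy : y = f 0) :
    ∃ j, (j = 0 ∨ IsCaterpillarVertex L i j) ∧ x = f j ∧ (j + 3) / 4 ≤ w.length := by
  induction w with
  | nil => exact ⟨0, Or.inl rfl, hy, by simp⟩
  | cons h w ih =>
    obtain ⟨k, hk, rfl, hl⟩ := ih hy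
    have hkL : k ≤ 4 * L := by
      rcases hk with rfl | hk
      · omega
      · exact hk.2.1
    obtain ⟨j, hj, ⟨rfl, h2⟩ | ⟨rfl, h2⟩⟩ := exists_of_caterpillar_adj h
    · have hlt := caterpillarParent_lt hj.1
      have := hf (Set.mem_Iic.2 hkL) (Set.mem_Iic.2 (hlt.le.trans hj.2.1)) h2
      subst this
      have := level_caterpillarParent hj.1
      exact ⟨j, Or.inr hj, rfl, by rw [Walk.length_cons]; omega⟩
    · have := hf (Set.mem_Iic.2 hkL) (Set.mem_Iic.2 hj.2.1) h2
      subst this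
      have := level_caterpillarParent hj.1
      exact ⟨_, hj.parent, rfl, by rw [Walk.length_cons]; omega⟩

theorem edist_caterpillar {f : ℕ → V} {L i : ℕ} (hf : Set.InjOn f (Set.Iic (4 * L))) {j : ℕ}
    (hj : j = 0 ∨ IsCaterpillarVertex L i j) :
    (caterpillar f L i).edist (f j) (f 0) = ((j + 3) / 4 : ℕ) := by
  obtain ⟨w, hw⟩ := exists_walk_caterpillar hf j hj
  refine le_antisymm (hw ▸ edist_le w) ?_
  obtain ⟨w', hw'⟩ := w.reachable.exists_walk_length_eq_edist
  obtain ⟨k, hk, hjk, hl⟩ := level_le_length_caterpillar hf w' rfl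
  have hle : ∀ {m}, (m = 0 ∨ IsCaterpillarVertex L i m) → m ≤ 4 * L := by
    rintro m (rfl | hm)
    · omega
    · exact hm.2.1
  have := hf (Set.mem_Iic.2 (hle hj)) (Set.mem_Iic.2 (hle hk)) hjk
  subst this
  rw [← hw']
  exact_mod_cast hl

/-- The binary digits of the number encoded by a caterpillar can be read off the sizes of the
spheres around the root. -/
theorem testBit_iff_exists_edist_caterpillar {f : ℕ → V} {L i d : ℕ}
    (hf : Set.InjOn f (Set.Iic (4 * L))) (hd : d + 2 ≤ L) :
    i.testBit d = true ↔ ∃ x y, x ≠ y ∧ (caterpillar f L i).edist x (f 0) = (d + 2 : ℕ) ∧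
      (caterpillar f L i).edist y (f 0) = (d + 2 : ℕ) := by
  constructor
  · intro hb
    -- The spine vertex and the digit leaf of level `d + 2`.
    refine ⟨f (4 * d + 5), f (4 * d + 6), fun h => ?_, ?_, ?_⟩
    · have := hf (Set.mem_Iic.2 (by omega)) (Set.mem_Iic.2 (by omega)) h
      omega
    · rw [edist_caterpillar hf (Or.inr ⟨by omega, by omega, by omega⟩)]
      congr 1
      omega
    · rw [edist_caterpillar hf (Or.inr ⟨by omega, by omega, Or.inr (Or.inr ⟨by omega, ?_⟩)⟩)]
      · congr 1
        omega
      · rw [← hb]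
        congr 1
        omega
  · rintro ⟨x, y, hne, hx, hy⟩
    have key : ∀ z, (caterpillar f L i).edist z (f 0) = (d + 2 : ℕ) →
        i.testBit d = true ∨ z = f (4 * d + 5) := by
      intro z hz
      obtain ⟨w, -⟩ := exists_walk_of_edist_eq_coe hz
      obtain ⟨j, hj, rfl, -⟩ := level_le_length_caterpillar hf w rfl
      rw [edist_caterpillar hf hj] at hz
      have hz : (j + 3) / 4 = d + 2 := by exact_mod_cast hz
      rcases hj with rfl | ⟨h1, h2, h3 | h3 | ⟨h3, h4⟩⟩
      · omega
      · omega
      · right; congr 1; omega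
      · left; rw [← h4]; congr 1; omega
    rcases key x hx with h | h
    · exact h
    · rcases key y hy with h' | h'
      · exact h'
      · exact absurd (h.trans h'.symm) hne

theorem Hom.edist_le {V' : Type*} {G : SimpleGraph V} {G' : SimpleGraph V'} (φ : G →g G')
    (x y : V) : G'.edist (φ x) (φ y) ≤ G.edist x y := by
  refine le_iInf fun w => ?_
  simpa using SimpleGraph.edist_le (w.map φ)

theorem Iso.edist_apply {V' : Type*} {G : SimpleGraph V} {G' : SimpleGraph V'} (φ : G ≃g G')
    (x y : V) : G'.edist (φ x) (φ y) = G.edist x y := by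
  refine le_antisymm (Hom.edist_le φ.toHom x y) ?_
  simpa using Hom.edist_le φ.symm.toHom (φ x) (φ y)

/-- The root is the only vertex of degree at least four, so an isomorphism preserves it, hence also
distances to it, and with them the digits at positions up to `L - 2`. All higher digits vanish by
the size bounds. -/
theorem eq_of_caterpillar_iso [Finite V] {f g : ℕ → V} {L i i' : ℕ} (hL : 1 ≤ L)
    (hf : Set.InjOn f (Set.Iic (4 * L))) (hg : Set.InjOn g (Set.Iic (4 * L)))
    (hi : i < 2 ^ (L - 1)) (hi' : i' < 2 ^ (L - 1))
    (φ : caterpillar f L i ≃g caterpillar g L i') : i = i' := by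
  have hroot : φ (f 0) = g 0 := by
    refine eq_root_of_four_le_ncard_neighborSet hg (i := i') ?_
    rw [← Nat.card_coe_set_eq, ← Nat.card_congr (φ.mapNeighborSet (f 0)), Nat.card_coe_set_eq]
    exact four_le_ncard_neighborSet_caterpillar hL hf
  refine Nat.eq_of_testBit_eq fun d => ?_
  by_cases hd : d + 2 ≤ L
  · rw [Bool.eq_iff_iff, testBit_iff_exists_edist_caterpillar hf hd,
      testBit_iff_exists_edist_caterpillar hg hd, ← hroot]
    constructor
    · rintro ⟨x, y, hne, hx, hy⟩
      exact ⟨φ x, φ y, φ.injective.ne hne, by rw [φ.edist_apply, hx], by rw [φ.edist_apply, hy]⟩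
    · rintro ⟨x, y, hne, hx, hy⟩
      refine ⟨φ.symm x, φ.symm y, φ.symm.injective.ne hne, ?_, ?_⟩
      · rw [← φ.edist_apply, φ.apply_symm_apply, hx]
      · rw [← φ.edist_apply, φ.apply_symm_apply, hy]
  · have h2 : 2 ^ (L - 1) ≤ 2 ^ d := Nat.pow_le_pow_right (by norm_num) (by omega)
    rw [Nat.testBit_lt_two_pow (hi.trans_le h2), Nat.testBit_lt_two_pow (hi'.trans_le h2)]

end SimpleGraph
-- Greedy embedding and packing of caterpillars
namespace SimpleGraph

variable {V : Type*}

/-- A graph with more than `d` times as many edges as nonisolated vertices has a nonempty subgraph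
in which every nonisolated vertex has degree more than `d`. -/
theorem exists_le_forall_lt_ncard_neighborSet [Finite V] (d : ℕ) (G : SimpleGraph V)
    (hG : d * G.support.ncard < G.edgeSet.ncard) :
    ∃ H ≤ G, H.support.Nonempty ∧ ∀ v ∈ H.support, d < (H.neighborSet v).ncard := by
  classical
  cases nonempty_fintype V
  induction hn : G.support.ncard using Nat.strong_induction_on generalizing G with
  | _ n ih =>
    subst hn
    by_cases h : ∀ v ∈ G.support, d < (G.neighborSet v).ncard
    · refine ⟨G, le_rfl, ?_, h⟩
      obtain ⟨e, he⟩ : G.edgeSet.Nonempty := Set.nonempty_of_ncard_ne_zero (by omega)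
      induction e with
      | h x y => exact ⟨x, y, he⟩
    · push Not at h
      obtain ⟨v, hv, hd⟩ := h
      have hlt : (G.deleteIncidenceSet v).support.ncard < G.support.ncard := by
        refine Set.ncard_lt_ncard ?_
        refine (G.support_deleteIncidenceSet_subset v).trans_ssubset ?_
        exact Set.sdiff_singleton_ssubset.2 hv
      have hle : G.edgeSet.ncard ≤ (G.deleteIncidenceSet v).edgeSet.ncard + d := by
        have h1 := G.card_edgeFinset_deleteIncidenceSet v
        have h2 : G.degree v = (G.neighborSet v).ncard := by
          rw [← card_neighborSet_eq_degree, ← Nat.card_eq_fintype_card, Nat.card_coe_set_eq]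
        have h3 : ∀ (H : SimpleGraph V) [Fintype H.edgeSet], H.edgeFinset.card = H.edgeSet.ncard := by
          intro H _
          rw [← Set.ncard_coe_finset, coe_edgeFinset]
        rw [h3, h3] at h1
        omega
      obtain ⟨H, hH, hne, hdeg⟩ := ih _ hlt (G.deleteIncidenceSet v) (by
        have : d * (G.deleteIncidenceSet v).support.ncard + d ≤ d * G.support.ncard := by
          rw [← Nat.mul_succ]
          exact Nat.mul_le_mul_left d hlt
        omega) rfl
      exact ⟨H, hH.trans (G.deleteIncidenceSet_le v), hne, hdeg⟩

/-- Every tree with `m` edges, given by a parent function, embeds greedily into a graph in which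
the degrees exceed `m`. -/
theorem exists_injOn_forall_adj_parent [Finite V] {H : SimpleGraph V} {m : ℕ}
    (hne : H.support.Nonempty) (hdeg : ∀ v ∈ H.support, m < (H.neighborSet v).ncard)
    {par : ℕ → ℕ} (hpar : ∀ j, 1 ≤ j → par j < j) :
    ∃ f : ℕ → V, Set.InjOn f (Set.Iic m) ∧ ∀ j, 1 ≤ j → j ≤ m → H.Adj (f j) (f (par j)) := by
  suffices h : ∀ k ≤ m, ∃ f : ℕ → V, Set.InjOn f (Set.Iic k) ∧ (∀ j ≤ k, f j ∈ H.support) ∧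
      ∀ j, 1 ≤ j → j ≤ k → H.Adj (f j) (f (par j)) by
    obtain ⟨f, h1, -, h2⟩ := h m le_rfl
    exact ⟨f, h1, h2⟩
  intro k
  induction k with
  | zero =>
    obtain ⟨v, hv⟩ := hne
    refine fun _ => ⟨fun _ => v, ?_, fun _ _ => hv, fun j h1 h2 => by omega⟩
    intro a ha b hb _
    simp only [Set.mem_Iic] at ha hb
    omega
  | succ k ih =>
    intro hk
    obtain ⟨f, hinj, hsupp, hadj⟩ := ih (by omega)
    have hp := hpar (k + 1) (by omega)
    -- Only `k + 1 ≤ m` vertices are occupied, while the parent has more than `m` neighbors.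
    obtain ⟨x, hx, hxf⟩ : ∃ x ∈ H.neighborSet (f (par (k + 1))), x ∉ f '' Set.Iic k := by
      refine Set.exists_mem_notMem_of_ncard_lt_ncard ?_
      have h1 := Set.ncard_image_le (f := f) (Set.finite_Iic k)
      have h2 := hdeg _ (hsupp (par (k + 1)) (by omega))
      have h3 : (Set.Iic k).ncard = k + 1 := by simp
      omega
    have hupd : ∀ j ≤ k, Function.update f (k + 1) x j = f j := fun j hj =>
      Function.update_of_ne (by omega) _ _
    have hself : Function.update f (k + 1) x (k + 1) = x := Function.update_self _ _ _
    refine ⟨Function.update f (k + 1) x, ?_, ?_, ?_⟩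
    · have hIic : Set.Iic (k + 1) = insert (k + 1) (Set.Iic k) := by
        ext j; simp only [Set.mem_Iic, Set.mem_insert_iff]; omega
      rw [hIic, Set.injOn_insert (by simp)]
      have heq : Set.EqOn (Function.update f (k + 1) x) f (Set.Iic k) := fun j hj => hupd j hj
      refine ⟨(heq.injOn_iff).2 hinj, ?_⟩
      rw [hself, heq.image_eq]
      exact hxf
    · intro j hj
      rcases Nat.lt_or_ge k j with h | h
      · obtain rfl : j = k + 1 := by omega
        rw [hself]
        exact ⟨_, SimpleGraph.Adj.symm hx⟩
      · rw [hupd j h]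
        exact hsupp j h
    · intro j h1 h2
      rcases Nat.lt_or_ge k j with h | h
      · obtain rfl : j = k + 1 := by omega
        rw [hself, hupd _ (by omega)]
        exact SimpleGraph.Adj.symm hx
      · have := hpar j h1
        rw [hupd j h, hupd _ (by omega)]
        exact hadj j h1 h

theorem exists_caterpillar_le [Finite V] {G : SimpleGraph V} {L : ℕ}
    (hG : 4 * L * Nat.card V < G.edgeSet.ncard) (i : ℕ) :
    ∃ f : ℕ → V, Set.InjOn f (Set.Iic (4 * L)) ∧ caterpillar f L i ≤ G := by
  have hs : G.support.ncard ≤ Nat.card V := Set.ncard_le_card _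
  obtain ⟨H, hH, hne, hdeg⟩ := exists_le_forall_lt_ncard_neighborSet (4 * L) G
    ((Nat.mul_le_mul_left _ hs).trans_lt hG)
  obtain ⟨f, hf, hadj⟩ :=
    exists_injOn_forall_adj_parent hne hdeg (fun _ => caterpillarParent_lt)
  exact ⟨f, hf, (caterpillar_le hadj).trans hH⟩

/-- Each removed caterpillar costs at most `4 * L` edges, so the budget `4 * L * t` keeps more than
`4 * L * Nat.card V` edges available at every stage, as `exists_caterpillar_le` requires. -/
theorem exists_disjoint_caterpillars [Finite V] {L : ℕ} (t : ℕ) (G : SimpleGraph V)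
    (hG : 4 * L * (Nat.card V + t) < G.edgeSet.ncard) :
    ∃ F : ℕ → SimpleGraph V,
      (∀ i < t, ∃ f : ℕ → V, Set.InjOn f (Set.Iic (4 * L)) ∧ F i = caterpillar f L i) ∧
      (∀ i < t, F i ≤ G) ∧ ∀ i < t, ∀ j < i, Disjoint (F j) (F i) := by
  induction t generalizing G with
  | zero => exact ⟨fun _ => ⊥, by simp, by simp, by simp⟩
  | succ t ih =>
    obtain ⟨f, hf, hle⟩ := exists_caterpillar_le (G := G) (L := L)
      (lt_of_le_of_lt (Nat.mul_le_mul_left _ (by omega)) hG) t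
    have hcard := ncard_edgeSet_caterpillar_le f L t
    have hsd : G.edgeSet.ncard - (caterpillar f L t).edgeSet.ncard ≤
        (G \ caterpillar f L t).edgeSet.ncard := by
      rw [edgeSet_sdiff]
      exact Set.le_ncard_sdiff _ _
    obtain ⟨F, hF, hFG, hdisj⟩ := ih (G \ caterpillar f L t) (by
      have : 4 * L * (Nat.card V + (t + 1)) = 4 * L * (Nat.card V + t) + 4 * L := by ring
      omega)
    have hupd : ∀ i < t, Function.update F t (caterpillar f L t) i = F i := fun i hi =>
      Function.update_of_ne (by omega) _ _
    have hself : Function.update F t (caterpillar f L t) t = caterpillar f L t :=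
      Function.update_self _ _ _
    refine ⟨Function.update F t (caterpillar f L t), ?_, ?_, ?_⟩
    · intro i hi
      rcases Nat.lt_succ_iff_lt_or_eq.1 hi with h | rfl
      · rw [hupd i h]
        exact hF i h
      · rw [hself]
        exact ⟨f, hf, rfl⟩
    · intro i hi
      rcases Nat.lt_succ_iff_lt_or_eq.1 hi with h | rfl
      · rw [hupd i h]
        exact (hFG i h).trans sdiff_le
      · rwa [hself]
    · intro i hi j hj
      rw [hupd j (by omega)]
      rcases Nat.lt_succ_iff_lt_or_eq.1 hi with h | rfl
      · rw [hupd i h]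
        exact hdisj i h j hj
      · rw [hself]
        exact disjoint_sdiff_self_left.mono_left (hFG j hj)

theorem IsNonIsoEdgeColoring.card_le_tau [Finite V] {G : SimpleGraph V} {K : Type*} [Fintype K]
    {C : G.EdgeLabeling K} (hC : IsNonIsoEdgeColoring C) : Fintype.card K ≤ G.tau := by
  let e := Fintype.equivFin K
  have hlab : ∀ i, (C.compRight e).labelGraph (e i) = C.labelGraph i := by
    intro i
    ext x y
    simp only [EdgeLabeling.labelGraph_adj, EdgeLabeling.compRight_apply, e.apply_eq_iff_eq]
  refine G.isGreatest_tau.2 ⟨C.compRight e, e.surjective.comp hC.1, fun i j hij => ?_⟩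
  obtain ⟨i, rfl⟩ := e.surjective i
  obtain ⟨j, rfl⟩ := e.surjective j
  rw [hlab, hlab]
  exact hC.2 i j fun h => hij (by rw [h])

/-- A family of nonempty, pairwise nonisomorphic, edge-disjoint subgraphs together with a larger
remainder forms a coloring. -/
theorem succ_le_tau [Finite V] {G : SimpleGraph V} {t m : ℕ} (F : Fin t → SimpleGraph V)
    (hle : ∀ i, F i ≤ G) (hdisj : Pairwise fun i j => Disjoint (F i) (F j))
    (hne : ∀ i, (F i).edgeSet.Nonempty) (hm : ∀ i, (F i).edgeSet.ncard ≤ m)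
    (hG : t * m + m < G.edgeSet.ncard)
    (hiso : ∀ i j, Nonempty (F i ≃g F j) → i = j) : t + 1 ≤ G.tau := by
  classical
  -- The color `none` collects the leftover edges; there are more than `m` of them, which separates
  -- it from every `F i` by size.
  let C : G.EdgeLabeling (Option (Fin t)) := fun e =>
    if h : ∃ i, (e : Sym2 V) ∈ (F i).edgeSet then some h.choose else none
  have hC : ∀ e i, C e = some i ↔ (e : Sym2 V) ∈ (F i).edgeSet := by
    intro e i
    by_cases h : ∃ i, (e : Sym2 V) ∈ (F i).edgeSet
    · simp only [C, dif_pos h, Option.some.injEq]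
      refine ⟨fun hi => hi ▸ h.choose_spec, fun hi => ?_⟩
      by_contra hne
      exact Set.disjoint_left.1 (disjoint_edgeSet.2 (hdisj hne)) h.choose_spec hi
    · simp only [C, dif_neg h, reduceCtorEq, false_iff]
      exact fun hi => h ⟨i, hi⟩
  have hsome : ∀ i, C.labelGraph (some i) = F i := by
    intro i
    ext x y
    simp only [EdgeLabeling.labelGraph_adj, hC, mem_edgeSet, exists_prop, and_iff_right_iff_imp]
    exact fun h => hle i h
  have hrest : m < (C.labelGraph none).edgeSet.ncard := by
    have hsum := C.sum_ncard_edgeSet_labelGraph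
    rw [Fintype.sum_option] at hsum
    have : ∑ i, (C.labelGraph (some i)).edgeSet.ncard ≤ t * m := by
      calc _ ≤ ∑ _i : Fin t, m := Finset.sum_le_sum fun i _ => by rw [hsome]; exact hm i
        _ = t * m := by simp
    omega
  have hsize : ∀ i, ¬ Nonempty (C.labelGraph (some i) ≃g C.labelGraph none) := by
    rintro i ⟨φ⟩
    have h1 := Nat.card_congr φ.mapEdgeSet
    rw [Nat.card_coe_set_eq, Nat.card_coe_set_eq, hsome] at h1
    have := hm i
    omega
  have hcol : IsNonIsoEdgeColoring C := by
    refine ⟨?_, ?_⟩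
    · rintro (_ | i)
      · obtain ⟨e, he⟩ : (C.labelGraph none).edgeSet.Nonempty :=
          Set.nonempty_of_ncard_ne_zero (by omega)
        induction e with
        | h x y =>
          obtain ⟨h, hc⟩ := (EdgeLabeling.labelGraph_adj x y).1 he
          exact ⟨_, hc⟩
      · obtain ⟨e, he⟩ := hne i
        exact ⟨⟨e, edgeSet_mono (hle i) he⟩, (hC _ i).2 he⟩
    · rintro (_ | i) (_ | j) hij
      · exact absurd rfl hij
      · exact fun ⟨φ⟩ => hsize j ⟨φ.symm⟩
      · exact hsize i
      · rw [hsome, hsome]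
        exact fun h => hij (by rw [hiso i j h])
  simpa using hcol.card_le_tau

theorem succ_le_tau_of_lt_ncard_edgeSet [Finite V] {G : SimpleGraph V} {L t : ℕ} (hL : 1 ≤ L)
    (hV : 1 ≤ Nat.card V) (ht : t ≤ 2 ^ (L - 1))
    (hG : 4 * L * (Nat.card V + t) < G.edgeSet.ncard) : t + 1 ≤ G.tau := by
  obtain ⟨F, hF, hFG, hdisj⟩ := exists_disjoint_caterpillars t G hG
  refine succ_le_tau (m := 4 * L) (fun i : Fin t => F i) (fun i => hFG i i.2) ?_ ?_ ?_ ?_ ?_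
  · intro i j hij
    rcases lt_or_gt_of_ne hij with h | h
    · exact hdisj j j.2 i h
    · exact (hdisj i i.2 j h).symm
  · intro i
    obtain ⟨f, hf, h⟩ := hF i i.2
    rw [h]
    exact ⟨s(f 1, f (caterpillarParent 1)),
      caterpillar_adj_parent hf ⟨le_rfl, by omega, Or.inl (by norm_num)⟩⟩
  · intro i
    obtain ⟨f, hf, h⟩ := hF i i.2
    rw [h]
    exact ncard_edgeSet_caterpillar_le f L i
  · refine lt_of_le_of_lt ?_ hG
    calc t * (4 * L) + 4 * L = 4 * L * (1 + t) := by ring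
      _ ≤ _ := by gcongr
  · rintro i j ⟨φ⟩
    obtain ⟨f, hf, hi⟩ := hF i i.2
    obtain ⟨g, hg, hj⟩ := hF j j.2
    rw [hi, hj] at φ
    exact Fin.ext (eq_of_caterpillar_iso hL hf hg (i.2.trans_le ht) (j.2.trans_le ht) φ)

end SimpleGraph
-- Concentration of the edge count and choice of parameters
open Filter Topology

namespace SimpleGraph

/-- If `p n ^ 2` tends to infinity, then the number of edges of `G(n, p)` is of order `p n ^ 2`
asymptotically almost surely. -/
theorem tendsto_binomialRandom_ncard_edgeSet {p : ℕ → unitInterval}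
    (hp : Tendsto (fun n : ℕ => (p n : ℝ) * (n : ℝ) ^ 2) atTop atTop) :
    Tendsto (fun n : ℕ => (binomialRandom (Fin n) (p n)).real
      {G | (p n : ℝ) * (n : ℝ) ^ 2 / 8 ≤ G.edgeSet.ncard ∧
        (G.edgeSet.ncard : ℝ) ≤ p n * (n : ℝ) ^ 2}) atTop (𝓝 1) := by
  have hlim : Tendsto (fun n : ℕ => 1 - 16 / ((p n : ℝ) * (n : ℝ) ^ 2)) atTop (𝓝 1) := by
    simpa using (tendsto_const_nhds (x := (1 : ℝ))).sub (hp.const_div_atTop 16)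
  refine tendsto_of_tendsto_of_tendsto_of_le_of_le' hlim tendsto_const_nhds ?_ ?_
  · filter_upwards [hp.eventually_gt_atTop 0, eventually_ge_atTop 2] with n hpos hn
    set x := (p n : ℝ) * (n : ℝ) ^ 2 with hx
    set y : ℝ := ((Nat.card (Fin n)).choose 2 : ℝ) * p n with hy
    have hp0 : (0 : ℝ) ≤ p n := (p n).2.1
    have hn' : (2 : ℝ) ≤ n := by exact_mod_cast hn
    have hxy : y = x / 2 - p n * n / 2 := by
      rw [hy, Nat.card_fin, Nat.cast_choose_two, hx]; ring
    have hpn : (p n : ℝ) * n ≤ x / 2 := by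
      rw [hx]; nlinarith [mul_nonneg hp0 (by linarith : (0 : ℝ) ≤ n)]
    have hpn0 : 0 ≤ (p n : ℝ) * n := by positivity
    have hy0 : x / 4 ≤ y := by linarith
    -- Since `x / 4 ≤ y ≤ x / 2`, a deviation below `y / 2` leaves the edge count between `x / 8`
    -- and `3 * x / 4`; the failure probability is at most `4 / y ≤ 16 / x`.
    have hcheb := binomialRandom_real_edgeSet_ncard_le (V := Fin n) (p n) (t := y / 2)
      (by linarith)
    rw [← hy] at hcheb
    set μ := binomialRandom (Fin n) (p n) with hμ
    have hmeas : ∀ S : Set (SimpleGraph (Fin n)), MeasurableSet S := fun S =>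
      (measurableEmbedding_edgeSet.measurableSet_image).1 (Set.toFinite _).measurableSet
    have hbound : y / (y / 2) ^ 2 ≤ 16 / x := by
      rw [div_le_div_iff₀ (by nlinarith) hpos]
      nlinarith
    have hcompl := MeasureTheory.probReal_compl_eq_one_sub (μ := μ)
      (hmeas {G | y / 2 ≤ |(G.edgeSet.ncard : ℝ) - y|})
    refine le_trans (b := 1 - y / (y / 2) ^ 2) (by linarith) ?_
    refine le_trans (b := μ.real {G | y / 2 ≤ |(G.edgeSet.ncard : ℝ) - y|}ᶜ) (by linarith) ?_
    refine MeasureTheory.measureReal_mono fun G hG => ?_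
    simp only [Set.mem_compl_iff, Set.mem_ofPred_eq, not_le, abs_lt] at hG ⊢
    constructor <;> linarith
  · exact Eventually.of_forall fun n => MeasureTheory.measureReal_le_one

theorem tau_lower_bound {n : ℕ} {G : SimpleGraph (Fin n)} (hn : 3 ≤ Real.log n)
    (hlow : 64 * (n * Real.log n) ≤ G.edgeSet.ncard) (hup : (G.edgeSet.ncard : ℝ) ≤ (n : ℝ) ^ 2) :
    G.edgeSet.ncard / (32 * Real.log n) ≤ (G.tau : ℝ) := by
  set ℓ := Real.log n with hℓ
  set m := G.edgeSet.ncard with hm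
  have hn0 : n ≠ 0 := by
    rintro rfl
    simp [hℓ] at hn
    norm_num at hn
  have hn1 : (1 : ℝ) ≤ n := by exact_mod_cast Nat.one_le_iff_ne_zero.2 hn0
  -- Chosen so that `2 ^ (L - 1) = (2 ^ (Nat.log 2 n + 1)) ^ 2` exceeds `n ^ 2`, hence the number of
  -- caterpillars needed, while `L` is still `O(log n)`.
  set L := 2 * Nat.log 2 n + 3 with hL
  have hLℓ : (4 * L : ℝ) ≤ 16 * ℓ := by
    have h1 : (2 : ℝ) ^ Nat.log 2 n ≤ n := by exact_mod_cast Nat.pow_log_le_self 2 hn0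
    have h2 := Real.log_le_log (by positivity) h1
    rw [Real.log_pow] at h2
    have h3 := Real.log_two_gt_d9
    have h4 : (0 : ℝ) ≤ Nat.log 2 n := Nat.cast_nonneg _
    rw [hL]
    push_cast
    nlinarith
  set t := ⌊(m : ℝ) / (32 * ℓ)⌋₊ with ht
  have htle : (t : ℝ) ≤ m / (32 * ℓ) := Nat.floor_le (by positivity)
  have htle' : t * (32 * ℓ) ≤ m := by rwa [le_div_iff₀ (by positivity)] at htle
  have htm : t ≤ m := by
    have h0 : (0 : ℝ) ≤ t := Nat.cast_nonneg _
    have : (t : ℝ) ≤ m := by nlinarith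
    exact_mod_cast this
  have hmn : m ≤ n ^ 2 := by exact_mod_cast hup
  have ht2 : t ≤ 2 ^ (L - 1) := by
    have h1 : n < 2 ^ (Nat.log 2 n + 1) := Nat.lt_pow_succ_log_self (by norm_num) n
    calc t ≤ n ^ 2 := htm.trans hmn
      _ ≤ (2 ^ (Nat.log 2 n + 1)) ^ 2 := Nat.pow_le_pow_left h1.le 2
      _ = 2 ^ (L - 1) := by rw [← pow_mul]; congr 1; omega
  -- The `n` term costs at most `m / 4` and the `t` term at most `m / 2`.
  have hkey : 4 * L * (Nat.card (Fin n) + t) < m := by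
    have h : (4 * L : ℝ) * (n + t) < m := by
      calc (4 * L : ℝ) * (n + t) ≤ 16 * ℓ * (n + t) := by gcongr
        _ = 16 * (n * ℓ) + t * (32 * ℓ) / 2 := by ring
        _ < m := by
          have : 0 < (n : ℝ) * ℓ := by positivity
          linarith
    rw [Nat.card_fin]
    exact_mod_cast h
  have h := succ_le_tau_of_lt_ncard_edgeSet (by omega)
    (by rw [Nat.card_fin]; exact Nat.one_le_iff_ne_zero.2 hn0) ht2 hkey
  calc (m : ℝ) / (32 * ℓ) ≤ t + 1 := (Nat.lt_floor_add_one _).le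
    _ ≤ G.tau := by exact_mod_cast h

theorem tau_upper_bound {n : ℕ} {G : SimpleGraph (Fin n)} (hn : 1 ≤ Real.log (Real.log n))
    (hn' : 8 * Real.log (Real.log n) ≤ Real.log n) :
    (G.tau : ℝ) ≤ 8 * (G.edgeSet.ncard * Real.log (Real.log n) / Real.log n) + n := by
  set ℓ := Real.log n with hℓ
  set r := Real.log ℓ with hr
  set m := G.edgeSet.ncard with hm
  have hℓ8 : 8 ≤ ℓ := by linarith
  have hn0 : n ≠ 0 := by
    rintro rfl
    simp [hℓ] at hℓ8
    norm_num at hℓ8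
  have hnpos : (0 : ℝ) < n := by exact_mod_cast Nat.pos_of_ne_zero hn0
  -- This puts `k` between `ℓ / (8 * r)` and `ℓ / (4 * r)`: large enough for `m / k ≤ 8 * (m * r /
  -- ℓ)`, and small enough that `(2k)^(2k) ≤ ℓ^(2k) = exp (2 * k * r) ≤ n`.
  set k := ⌊ℓ / (8 * r)⌋₊ + 1 with hk
  have hk1 : ℓ / (8 * r) ≤ k := by
    rw [hk]; push_cast; exact (Nat.lt_floor_add_one _).le
  have hk2 : (k : ℝ) ≤ ℓ / (4 * r) := by
    have h1 : (⌊ℓ / (8 * r)⌋₊ : ℝ) ≤ ℓ / (8 * r) := Nat.floor_le (by positivity)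
    have h2 : 1 ≤ ℓ / (8 * r) := by rwa [le_div_iff₀ (by positivity), one_mul]
    have h3 : ℓ / (4 * r) = ℓ / (8 * r) + ℓ / (8 * r) := by field_simp; norm_num
    rw [hk]; push_cast; linarith
  have hkr : 4 * (k * r) ≤ ℓ := by
    rw [le_div_iff₀ (by positivity)] at hk2; linarith
  have hk0 : (1 : ℝ) ≤ k := by exact_mod_cast Nat.le_add_left 1 _
  have h2k : (2 * k : ℝ) ≤ ℓ := by nlinarith
  have hℓn : ℓ ≤ n := (Real.log_le_sub_one_of_pos hnpos).trans (by linarith)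
  have hcard : 2 * k ≤ Nat.card (Fin n) := by
    rw [Nat.card_fin]; exact_mod_cast h2k.trans hℓn
  have hmain := G.mul_tau_le hcard
  have hpow : ((2 * k : ℕ) : ℝ) ^ (2 * k) ≤ n := by
    calc ((2 * k : ℕ) : ℝ) ^ (2 * k) ≤ ℓ ^ (2 * k) := by
          gcongr; push_cast; exact h2k
      _ = Real.exp (2 * k * r) := by
          rw [hr, ← Real.rpow_natCast, Real.rpow_def_of_pos (by linarith)]
          congr 1; push_cast; ring
      _ ≤ Real.exp ℓ := by
          gcongr
          nlinarith
      _ = n := Real.exp_log hnpos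
  have hmain' : (k : ℝ) * G.tau ≤ m + k * ((2 * k : ℕ) : ℝ) ^ (2 * k) := by exact_mod_cast hmain
  have h1 : (G.tau : ℝ) ≤ m / k + n := by
    rw [← sub_le_iff_le_add, le_div_iff₀ (by linarith)]
    nlinarith
  have h2 : (m : ℝ) / k ≤ 8 * (m * r / ℓ) := by
    calc (m : ℝ) / k ≤ m / (ℓ / (8 * r)) := by gcongr
      _ = 8 * (m * r / ℓ) := by field_simp
  linarith

end SimpleGraph

theorem theorem1 :
    ∃ C : ℝ, 0 < C ∧ ∃ a : ℝ, 0 < a ∧ ∃ b : ℝ, 0 < b ∧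
      ∀ p : ℕ → unitInterval,
        (∀ᶠ n : ℕ in Filter.atTop,
          C * Real.log n / n ≤ (p n : ℝ) ∧ (p n : ℝ) ≤ 1 / Real.log n) →
        Filter.Tendsto
          (fun n : ℕ => SimpleGraph.binomialRandom (Fin n) (p n)
            {G : SimpleGraph (Fin n) |
              a * ((p n : ℝ) * (n : ℝ) ^ 2 / Real.log n) ≤ (G.tau : ℝ) ∧
              (G.tau : ℝ) ≤
                b * ((p n : ℝ) * (n : ℝ) ^ 2 * Real.log (Real.log n) / Real.log n)})
          Filter.atTop (nhds 1) := by
  -- With at least `p n ^ 2 / 8` edges, `512 = 8 * 64` meets the edge requirement of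
  -- `tau_lower_bound` and `256 = 8 * 32` comes from its conclusion. In `9 = 8 + 1` the extra `1`
  -- absorbs the additive `n` of `tau_upper_bound`.
  refine ⟨512, by norm_num, 1 / 256, by norm_num, 9, by norm_num, fun p hp => ?_⟩
  have hlog : Tendsto (fun n : ℕ => Real.log n) atTop atTop :=
    Real.tendsto_log_atTop.comp tendsto_natCast_atTop_atTop
  have hloglog : Tendsto (fun n : ℕ => Real.log (Real.log n)) atTop atTop :=
    Real.tendsto_log_atTop.comp hlog
  have hbig : ∀ᶠ n : ℕ in atTop, 8 * Real.log (Real.log n) ≤ Real.log n := by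
    have := hlog.eventually (Real.isLittleO_log_id_atTop.bound (c := 1 / 8) (by norm_num))
    filter_upwards [this, hlog.eventually_ge_atTop 0, hloglog.eventually_ge_atTop 0]
      with n h h0 h1
    simp only [id, Real.norm_eq_abs, abs_of_nonneg h0, abs_of_nonneg h1] at h
    linarith
  have hpn : ∀ᶠ n : ℕ in atTop, 512 * (n * Real.log n) ≤ (p n : ℝ) * (n : ℝ) ^ 2 := by
    filter_upwards [hp, eventually_gt_atTop 0] with n h hn
    have hn' : (0 : ℝ) < n := by exact_mod_cast hn
    have := (div_le_iff₀ hn').1 h.1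
    nlinarith
  have hnlog : Tendsto (fun n : ℕ => 512 * (n * Real.log n)) atTop atTop :=
    (tendsto_natCast_atTop_atTop.atTop_mul_atTop₀ hlog).const_mul_atTop (by norm_num)
  have hmain := SimpleGraph.tendsto_binomialRandom_ncard_edgeSet (tendsto_atTop_mono' _ hpn hnlog)
  have hreal : Tendsto (fun n : ℕ => ENNReal.ofReal ((SimpleGraph.binomialRandom (Fin n) (p n)).real
      {G | (p n : ℝ) * (n : ℝ) ^ 2 / 8 ≤ G.edgeSet.ncard ∧
        (G.edgeSet.ncard : ℝ) ≤ p n * (n : ℝ) ^ 2})) atTop (𝓝 1) := by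
    simpa using ENNReal.tendsto_ofReal hmain
  refine tendsto_of_tendsto_of_tendsto_of_le_of_le' hreal tendsto_const_nhds ?_
    (Eventually.of_forall fun n => MeasureTheory.prob_le_one)
  filter_upwards [hpn, hbig, hloglog.eventually_ge_atTop 1, hlog.eventually_ge_atTop 3]
    with n h1 h2 h3 h4
  rw [MeasureTheory.ofReal_measureReal]
  refine MeasureTheory.measure_mono fun G hG => ?_
  obtain ⟨hlow, hup⟩ := hG
  have hn0 : (0 : ℝ) ≤ n := Nat.cast_nonneg n
  have hp1 : (p n : ℝ) ≤ 1 := (p n).2.2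
  constructor
  · refine le_trans ?_ (SimpleGraph.tau_lower_bound h4 (by linarith)
      (hup.trans (mul_le_of_le_one_left (by positivity) hp1)))
    calc 1 / 256 * ((p n : ℝ) * (n : ℝ) ^ 2 / Real.log n)
        = (p n : ℝ) * (n : ℝ) ^ 2 / 8 / (32 * Real.log n) := by ring
      _ ≤ _ := by gcongr
  · refine (SimpleGraph.tau_upper_bound h3 h2).trans ?_
    set x := (p n : ℝ) * (n : ℝ) ^ 2 with hx
    have hstep : (G.edgeSet.ncard : ℝ) * Real.log (Real.log n) / Real.log n ≤
        x * Real.log (Real.log n) / Real.log n := by gcongr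
    have hn : (n : ℝ) ≤ x * Real.log (Real.log n) / Real.log n := by
      rw [le_div_iff₀ (by linarith)]
      have : 0 ≤ (n : ℝ) * Real.log n := by positivity
      nlinarith
    linarith
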